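/- Conventions. A $\lambda$-ring is a commutative ring $R$ with operations $\lambda^n\colon R\to R$ ($n\ge 0$) such that $\lambda^0(x)=1$, $\lambda^1(x)=x$, $\lambda^n(x+y)=\sum_{i+j=n}\lambda^i(x)\lambda^j(y)$, $\lambda^n(1)=0$ for $n\ge 2$, and $\lambda^n(xy)$ and $\lambda^m(\lambda^n(x))$ are given by the usual universal integer polynomials $P_n(\lambda^1x,\dots,\lambda^nx;\lambda^1y,\dots,\lambda^ny)$ and $P_{m,n}(\lambda^1x,\dots,\lambda^{mn}x)$ (a "special $\lambda$-ring" in older terminology). For a partition $\mu$ with conjugate $\mu'$ having $c$ parts, let $s_\mu=\det(e_{\mu'_i+j-i})_{1\le i,j\le c}$ be the Schur function in the ring of symmetric functions $\Lambda=\mathbb{Z}[e_1,e_2,\dots]$ (with $e_0=1$ and $e_k=0$ for $k<0$), and for $x\in R$ let $s_\mu(x)\in R$ be its image under the ring homomorphism $\Lambda\to R$ with $e_n\mapsto\lambda^n(x)$. An element $x\in R$ has bound $\mu$ if $s_\nu(x)=0$ for every partition $\nu$ whose Young diagram contains that of $\mu$; it is Schur-finite if it has some bound. A line element is an element $\ell$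 with $\lambda^n(\ell)=0$ for all $n>1$. An element $y$ is even if $\lambda^n(y)=0$ for all sufficiently large $n$, and an element is finite-dimensional if it is a difference of two even elements. Theorem. Let $R$ be a $\lambda$-ring and let $x\in R$ be a (Schur-finite) element with bound $(2,1)$. Then there exist a $\lambda$-ring $R'$, an injective homomorphism of $\lambda$-rings $R\hookrightarrow R'$, and line elements $\ell_1,\ell_2,a\in R'$ such that $x=\ell_1+\ell_2-a$ in $R'$. So the virtual splitting principle holds for elements with bound the hook $(2,1)$: $x$ is a difference of sums of line elements in $R'$, and in particular it is finite-dimensional in $R'$. -/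

import Mathlib

universe u

section UniversalPolynomials

/-- The `n`-th elementary symmetric polynomial of the finite family `(f i)_{i ∈ s}`. -/
def elemSymm {ι A : Type*} [CommRing A] (s : Finset ι) (f : ι → A) (n : ℕ) : A :=
  ∑ T ∈ s.powersetCard n, ∏ i ∈ T, f i

/-- `P(e₁, …, eₙ; f₁, …, fₙ) = eₙ({ξᵢ ηⱼ})`, that is, the coefficient of `tⁿ` in
`∏ᵢⱼ (1 + ξᵢ ηⱼ t)`. Here `eᵢ`, `fⱼ` are the elementary symmetric polynomials in the independent
variables `ξ₁, …, ξₙ` and `η₁, …, ηₙ`. The variable of `P` with index `i : Fin n` stands for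
the elementary symmetric polynomial of degree `i + 1`. -/
def IsMulPoly (n : ℕ) (P : MvPolynomial (Fin n ⊕ Fin n) ℤ) : Prop :=
  MvPolynomial.aeval
      (Sum.elim
        (fun i : Fin n =>
          elemSymm Finset.univ
            (fun k : Fin n => (MvPolynomial.X (Sum.inl k) : MvPolynomial (Fin n ⊕ Fin n) ℤ))
            (i + 1))
        (fun j : Fin n =>
          elemSymm Finset.univ
            (fun k : Fin n => (MvPolynomial.X (Sum.inr k) : MvPolynomial (Fin n ⊕ Fin n) ℤ))
            (j + 1))) P =
    elemSymm (Finset.univ : Finset (Fin n × Fin n))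
      (fun c => (MvPolynomial.X (Sum.inl c.1) * MvPolynomial.X (Sum.inr c.2) :
        MvPolynomial (Fin n ⊕ Fin n) ℤ)) n

/-- `P(e₁, …, e_{mn}) = e_m({ξ_{i₁} ⋯ ξ_{iₙ} : i₁ < ⋯ < iₙ})`, that is, the coefficient of `t^m`
in `∏_{i₁ < ⋯ < iₙ} (1 + ξ_{i₁} ⋯ ξ_{iₙ} t)`. Here `eᵢ` are the elementary symmetric polynomials
in the independent variables `ξ₁, …, ξ_{mn}`. -/
def IsCompPoly (m n : ℕ) (P : MvPolynomial (Fin (m * n)) ℤ) : Prop :=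
  MvPolynomial.aeval
      (fun i : Fin (m * n) =>
        elemSymm Finset.univ
          (fun k : Fin (m * n) => (MvPolynomial.X k : MvPolynomial (Fin (m * n)) ℤ)) (i + 1)) P =
    elemSymm (Finset.powersetCard n (Finset.univ : Finset (Fin (m * n))))
      (fun S => ∏ i ∈ S, (MvPolynomial.X i : MvPolynomial (Fin (m * n)) ℤ)) m

theorem elemSymm_X_eq_esymm (σ A : Type*) [Fintype σ] [CommRing A] (n : ℕ) :
    elemSymm Finset.univ (fun k : σ => (MvPolynomial.X k : MvPolynomial σ A)) n =
      MvPolynomial.esymm σ A n := rfl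

theorem map_elemSymm {ι A B : Type*} [CommRing A] [CommRing B] (φ : A →+* B) (s : Finset ι)
    (f : ι → A) (n : ℕ) : φ (elemSymm s f n) = elemSymm s (fun i => φ (f i)) n := by
  simp [elemSymm, map_sum, map_prod]

theorem elemSymm_zero {ι A : Type*} [CommRing A] (s : Finset ι) (f : ι → A) :
    elemSymm s f 0 = 1 := by
  simp [elemSymm]

theorem coeff_prod_one_add {ι A : Type*} [CommRing A] [DecidableEq ι] (s : Finset ι)
    (f : ι → A) (n : ℕ) :
    (∏ i ∈ s, (1 + Polynomial.C (f i) * Polynomial.X)).coeff n = elemSymm s f n := by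
  rw [Finset.prod_one_add, Polynomial.finsetSum_coeff, elemSymm, Finset.powersetCard_eq_filter,
    Finset.sum_filter]
  refine Finset.sum_congr rfl fun T _ => ?_
  rw [Finset.prod_mul_distrib, Finset.prod_const, ← map_prod, Polynomial.coeff_C_mul_X_pow]
  simp only [eq_comm]

theorem prod_one_add_eq_sum {ι A : Type*} [CommRing A] [Fintype ι] [DecidableEq ι]
    (f : ι → A) {n : ℕ} (hn : Fintype.card ι = n) :
    ∏ i, (1 + Polynomial.C (f i) * Polynomial.X) =
      ∑ k ∈ Finset.range (n + 1),
        Polynomial.C (elemSymm Finset.univ f k) * Polynomial.X ^ k := by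
  ext d
  rw [coeff_prod_one_add, Polynomial.finsetSum_coeff]
  simp only [Polynomial.coeff_C_mul_X_pow]
  rw [Finset.sum_ite_eq]
  split_ifs with h
  · rfl
  · have : n < d := by simpa using h
    rw [elemSymm, Finset.powersetCard_eq_empty.2 (by simpa [hn] using this), Finset.sum_empty]

theorem aeval_esymm_injective (A : Type*) [CommRing A] (N : ℕ) :
    Function.Injective (MvPolynomial.aeval (R := A)
      fun i : Fin N => MvPolynomial.esymm (Fin N) A (i + 1)) := by
  intro a b hab
  apply MvPolynomial.esymmAlgHom_injective (σ := Fin N) A (n := N) (by rw [Fintype.card_fin])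
  apply Subtype.ext
  rw [MvPolynomial.esymmAlgHom_apply, MvPolynomial.esymmAlgHom_apply]
  exact hab

theorem exists_aeval_esymm_eq (A : Type*) [CommRing A] (N : ℕ) (Q : MvPolynomial (Fin N) A)
    (hQ : Q.IsSymmetric) :
    ∃ P, MvPolynomial.aeval (R := A)
      (fun i : Fin N => MvPolynomial.esymm (Fin N) A (i + 1)) P = Q := by
  obtain ⟨P, hP⟩ := MvPolynomial.esymmAlgHom_surjective (σ := Fin N) A (n := N)
    (by rw [Fintype.card_fin]) ⟨Q, hQ⟩
  refine ⟨P, ?_⟩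
  have := congrArg Subtype.val hP
  rwa [MvPolynomial.esymmAlgHom_apply] at this

theorem rename_elemSymm_powersetCard {σ : Type*} [Fintype σ] (m n : ℕ) (e : Equiv.Perm σ) :
    MvPolynomial.rename e (elemSymm (Finset.powersetCard n (Finset.univ : Finset σ))
      (fun S => ∏ i ∈ S, (MvPolynomial.X i : MvPolynomial σ ℤ)) m) =
    elemSymm (Finset.powersetCard n (Finset.univ : Finset σ))
      (fun S => ∏ i ∈ S, (MvPolynomial.X i : MvPolynomial σ ℤ)) m := by
  classical
  have h1 : MvPolynomial.rename e (elemSymm (Finset.powersetCard n (Finset.univ : Finset σ))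
      (fun S => ∏ i ∈ S, (MvPolynomial.X i : MvPolynomial σ ℤ)) m) =
      elemSymm (Finset.powersetCard n (Finset.univ : Finset σ))
        (fun S => ∏ i ∈ S, (MvPolynomial.X (e i) : MvPolynomial σ ℤ)) m := by
    simp only [elemSymm, map_sum, map_prod, MvPolynomial.rename_X]
  have h2 : ∏ S ∈ Finset.powersetCard n (Finset.univ : Finset σ),
      (1 + Polynomial.C (∏ i ∈ S, (MvPolynomial.X (e i) : MvPolynomial σ ℤ)) * Polynomial.X) =
      ∏ S ∈ Finset.powersetCard n (Finset.univ : Finset σ),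
      (1 + Polynomial.C (∏ i ∈ S, (MvPolynomial.X i : MvPolynomial σ ℤ)) * Polynomial.X) := by
    refine Finset.prod_equiv (Equiv.finsetCongr e) (fun S => ?_) (fun S _ => ?_)
    · rw [Finset.mem_powersetCard_univ, Finset.mem_powersetCard_univ, Equiv.finsetCongr_apply,
        Finset.card_map]
    · rw [Equiv.finsetCongr_apply, Finset.prod_map]
      rfl
  rw [h1, ← coeff_prod_one_add, ← coeff_prod_one_add, h2]

theorem existsUnique_isCompPoly (m n : ℕ) : ∃! P, IsCompPoly m n P := by
  obtain ⟨P, hP⟩ := exists_aeval_esymm_eq ℤ (m * n) _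
    (fun e => rename_elemSymm_powersetCard m n e)
  refine ⟨P, hP, fun P' hP' => aeval_esymm_injective ℤ (m * n) ?_⟩
  exact Eq.trans hP' hP.symm

theorem existsUnique_isMulPoly (n : ℕ) : ∃! P, IsMulPoly n P := by
  classical
  -- the polynomial in `ξ` with coefficients in `ℤ[f₁, …, fₙ]`
  let f : ℕ → MvPolynomial (Fin n) ℤ := fun k => if h : k - 1 < n then (if k = 0 then 1 else MvPolynomial.X ⟨k - 1, h⟩)
    else 1
  have hf0 : f 0 = 1 := by simp [f]
  have hfs : ∀ j : Fin n, f (j + 1) = MvPolynomial.X j := by intro j; simp [f]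
  let G : Polynomial (MvPolynomial (Fin n) (MvPolynomial (Fin n) ℤ)) := ∏ i : Fin n, ∑ k ∈ Finset.range (n + 1),
    Polynomial.C (MvPolynomial.C (f k) * MvPolynomial.X i ^ k) * Polynomial.X ^ k
  have hsym : (G.coeff n).IsSymmetric := by
    intro e
    have h1 : MvPolynomial.rename e (G.coeff n) = (G.map
        (MvPolynomial.rename (R := MvPolynomial (Fin n) ℤ) e : _ →ₐ[MvPolynomial (Fin n) ℤ] MvPolynomial (Fin n) (MvPolynomial (Fin n) ℤ)).toRingHom).coeff n := by
      simp
    rw [h1]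
    congr 1
    simp only [G, Polynomial.map_prod, Polynomial.map_sum]
    conv_rhs => rw [← Equiv.prod_comp e]
    simp
  let φ : MvPolynomial (Fin n) ℤ →ₐ[ℤ] MvPolynomial (Fin n) ℤ := MvPolynomial.aeval fun i : Fin n => MvPolynomial.esymm (Fin n) ℤ (i + 1)
  have hφ : Function.Injective φ := aeval_esymm_injective ℤ n
  let ε : MvPolynomial (Fin n) (MvPolynomial (Fin n) ℤ) →ₐ[MvPolynomial (Fin n) ℤ] MvPolynomial (Fin n) (MvPolynomial (Fin n) ℤ) :=
    MvPolynomial.aeval fun i : Fin n => MvPolynomial.esymm (Fin n) (MvPolynomial (Fin n) ℤ) (i + 1)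
  have hε : Function.Injective ε := aeval_esymm_injective (MvPolynomial (Fin n) ℤ) n
  let s := MvPolynomial.sumAlgEquiv ℤ (Fin n) (Fin n)
  let L : MvPolynomial (Fin n ⊕ Fin n) ℤ →+* MvPolynomial (Fin n) (MvPolynomial (Fin n) ℤ) :=
    (ε.toRingHom.comp (MvPolynomial.map φ.toRingHom)).comp s.toRingEquiv.toRingHom
  let L' : MvPolynomial (Fin n ⊕ Fin n) ℤ →ₐ[ℤ] MvPolynomial (Fin n ⊕ Fin n) ℤ :=
    MvPolynomial.aeval
      (Sum.elim
        (fun i : Fin n =>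
          elemSymm Finset.univ
            (fun k : Fin n => (MvPolynomial.X (Sum.inl k) : MvPolynomial (Fin n ⊕ Fin n) ℤ))
            (i + 1))
        (fun j : Fin n =>
          elemSymm Finset.univ
            (fun k : Fin n => (MvPolynomial.X (Sum.inr k) : MvPolynomial (Fin n ⊕ Fin n) ℤ))
            (j + 1)))
  have hL : ∀ P, s (L' P) = L P := by
    intro P
    have : s.toRingEquiv.toRingHom.comp L'.toRingHom = L := by
      apply MvPolynomial.ringHom_ext
      · intro r; simp
      · rintro (i | j)
        · have := map_elemSymm s.toRingEquiv.toRingHom Finset.univ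
            (fun k : Fin n => (MvPolynomial.X (Sum.inl k) : MvPolynomial (Fin n ⊕ Fin n) ℤ))
            (i + 1)
          simp [L, L', s, ε] at this ⊢
          rw [this, elemSymm_X_eq_esymm]
        · have := map_elemSymm s.toRingEquiv.toRingHom Finset.univ
            (fun k : Fin n => (MvPolynomial.X (Sum.inr k) : MvPolynomial (Fin n ⊕ Fin n) ℤ))
            (j + 1)
          have h2 := map_elemSymm (MvPolynomial.C : MvPolynomial (Fin n) ℤ →+* MvPolynomial (Fin n) (MvPolynomial (Fin n) ℤ)) Finset.univ
            (fun k : Fin n => (MvPolynomial.X k : MvPolynomial (Fin n) ℤ)) (j + 1)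
          rw [elemSymm_X_eq_esymm] at h2
          simp [L, L', s, ε, φ] at this ⊢
          rw [this]
          exact h2.symm
    exact congrArg (fun g : _ →+* _ => g P) this
  have hLinj : Function.Injective L := by
    intro a b hab
    exact s.injective (MvPolynomial.map_injective _ hφ (hε hab))
  -- the value at the elementary symmetric polynomials in `η`
  have hval : MvPolynomial.map φ.toRingHom (G.coeff n) =
      s (elemSymm (Finset.univ : Finset (Fin n × Fin n))
        (fun c => (MvPolynomial.X (Sum.inl c.1) * MvPolynomial.X (Sum.inr c.2) :
          MvPolynomial (Fin n ⊕ Fin n) ℤ)) n) := by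
    have h1 := map_elemSymm s.toRingEquiv.toRingHom Finset.univ
      (fun c : Fin n × Fin n => (MvPolynomial.X (Sum.inl c.1) * MvPolynomial.X (Sum.inr c.2) :
          MvPolynomial (Fin n ⊕ Fin n) ℤ)) n
    have h2 : ∀ p, s.toRingEquiv.toRingHom p = s p := fun _ => rfl
    rw [h2] at h1
    rw [h1, ← coeff_prod_one_add, ← Polynomial.coeff_map]
    congr 1
    simp only [G, Polynomial.map_prod, Polynomial.map_sum]
    rw [Fintype.prod_prod_type]
    refine Finset.prod_congr rfl fun i _ => ?_
    rw [prod_one_add_eq_sum _ (n := n) (by simp)]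
    refine Finset.sum_congr rfl fun k hk => ?_
    simp only [Polynomial.map_mul, Polynomial.map_C, Polynomial.map_pow, Polynomial.map_X, h2]
    congr 2
    have h3 : elemSymm Finset.univ (fun j : Fin n => s (MvPolynomial.X (Sum.inl i) *
        MvPolynomial.X (Sum.inr j))) k =
        MvPolynomial.C (MvPolynomial.esymm (Fin n) ℤ k) * MvPolynomial.X i ^ k := by
      rw [← elemSymm_X_eq_esymm, map_elemSymm]
      simp only [elemSymm, Finset.sum_mul]
      refine Finset.sum_congr rfl fun T hT => ?_
      rw [← (Finset.mem_powersetCard.1 hT).2]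
      simp [s, Finset.prod_mul_distrib, mul_comm]
    rw [h3]
    have h4 : φ (f k) = MvPolynomial.esymm (Fin n) ℤ k := by
      rcases k with _ | k
      · simp [hf0]
      · have hk' : k < n := by simpa using hk
        have := hfs ⟨k, hk'⟩
        simp only at this
        rw [this]
        simp only [φ]
        rw [MvPolynomial.aeval_X]
    simp [h4]
  obtain ⟨P₁, hP₁⟩ := exists_aeval_esymm_eq (MvPolynomial (Fin n) ℤ) n (G.coeff n) hsym
  have hP₁' : ε P₁ = G.coeff n := hP₁
  have hcomm : ∀ p, ε (MvPolynomial.map φ.toRingHom p) = MvPolynomial.map φ.toRingHom (ε p) := by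
    intro p
    have : ε.toRingHom.comp (MvPolynomial.map φ.toRingHom) =
        (MvPolynomial.map φ.toRingHom).comp ε.toRingHom := by
      apply MvPolynomial.ringHom_ext
      · intro r; simp [ε]
      · intro i; simp [ε, MvPolynomial.map_esymm]
    exact congrArg (fun g : _ →+* _ => g p) this
  have hs : L (s.symm P₁) = s (elemSymm (Finset.univ : Finset (Fin n × Fin n))
        (fun c => (MvPolynomial.X (Sum.inl c.1) * MvPolynomial.X (Sum.inr c.2) :
          MvPolynomial (Fin n ⊕ Fin n) ℤ)) n) := by
    rw [← hval, ← hP₁', ← hcomm]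
    change ε (MvPolynomial.map φ.toRingHom (s (s.symm P₁))) = _
    rw [AlgEquiv.apply_symm_apply]
  refine ⟨s.symm P₁, ?_, fun P' hP' => ?_⟩
  · apply s.injective
    exact (hL _).trans hs
  · apply hLinj
    rw [hs, ← hL]
    exact congrArg s hP'

/-- The universal polynomial `Pₙ` with `λⁿ(xy) = Pₙ(λ¹x, …, λⁿx; λ¹y, …, λⁿy)`. -/
noncomputable def mulPoly (n : ℕ) : MvPolynomial (Fin n ⊕ Fin n) ℤ :=
  (existsUnique_isMulPoly n).choose

theorem isMulPoly_mulPoly (n : ℕ) : IsMulPoly n (mulPoly n) :=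
  (existsUnique_isMulPoly n).choose_spec.1

/-- The universal polynomial `P_{m,n}` with `λᵐ(λⁿx) = P_{m,n}(λ¹x, …, λᵐⁿx)`. -/
noncomputable def compPoly (m n : ℕ) : MvPolynomial (Fin (m * n)) ℤ :=
  (existsUnique_isCompPoly m n).choose

theorem isCompPoly_compPoly (m n : ℕ) : IsCompPoly m n (compPoly m n) :=
  (existsUnique_isCompPoly m n).choose_spec.1

end UniversalPolynomials

/-- A `λ`-ring (a "special" `λ`-ring in the older terminology): a commutative ring with
operations `λⁿ` such that `λ_t = ∑ λⁿ tⁿ` is additive-to-multiplicative, `λ_t(1) = 1 + t`, and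
`λⁿ(xy)`, `λᵐ(λⁿx)` are given by the universal polynomials. -/
class LambdaRing (R : Type u) extends CommRing R where
  /-- The operation `λⁿ`. -/
  lam : ℕ → R → R
  lam_zero : ∀ x, lam 0 x = 1
  lam_one : ∀ x, lam 1 x = x
  lam_add : ∀ n x y, lam n (x + y) =
    ∑ p ∈ Finset.HasAntidiagonal.antidiagonal n, lam p.1 x * lam p.2 y
  lam_of_one : ∀ n, 2 ≤ n → lam n 1 = 0
  lam_mul : ∀ n x y, lam n (x * y) =
    MvPolynomial.aeval
      (Sum.elim (fun i : Fin n => lam (i + 1) x) (fun j : Fin n => lam (j + 1) y)) (mulPoly n)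
  lam_lam : ∀ m n x, lam m (lam n x) =
    MvPolynomial.aeval (fun i : Fin (m * n) => lam (i + 1) x) (compPoly m n)

/-- A homomorphism of `λ`-rings. -/
structure LambdaRingHom (R : Type*) (S : Type*) [LambdaRing R] [LambdaRing S] extends
    R →+* S where
  map_lam : ∀ n x, toRingHom (LambdaRing.lam n x) = LambdaRing.lam n (toRingHom x)

/-- The element `e_k` (`k ∈ ℤ`) of the ring of symmetric functions `Λ = ℤ[e₁, e₂, …]`, where the
variable with index `i` is `e_{i+1}`, `e₀ = 1`, and `e_k = 0` for `k < 0`. -/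
noncomputable def elemFn (k : ℤ) : MvPolynomial ℕ ℤ :=
  if k < 0 then 0 else if k = 0 then 1 else MvPolynomial.X (k.toNat - 1)

/-- The Schur function `s_μ = det (e_{μ'_i + j - i})` in `Λ = ℤ[e₁, e₂, …]`, where `μ'_i` are
the column lengths of `μ` and the size of the matrix is the number of columns of `μ`. -/
noncomputable def schurFn (μ : YoungDiagram) : MvPolynomial ℕ ℤ :=
  Matrix.det (Matrix.of fun i j : Fin (μ.rowLen 0) =>
    elemFn ((μ.colLen i : ℤ) + (j : ℤ) - (i : ℤ)))

section Elements

variable {R : Type*} [LambdaRing R]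

/-- The ring homomorphism `u_x : Λ → R` with `u_x(eₙ) = λⁿ(x)`. -/
noncomputable def evalSymm (x : R) : MvPolynomial ℕ ℤ →ₐ[ℤ] R :=
  MvPolynomial.aeval fun i : ℕ => LambdaRing.lam (i + 1) x

/-- `x` has bound `μ`: `s_ν(x) = 0` for every partition `ν` whose diagram contains that of `μ`. -/
def HasBound (x : R) (μ : YoungDiagram) : Prop :=
  ∀ ν : YoungDiagram, μ ≤ ν → evalSymm x (schurFn ν) = 0

/-- `ℓ` is a line element: `λⁿ(ℓ) = 0` for all `n > 1`. -/
def IsLineElement (ℓ : R) : Prop := ∀ n, 1 < n → LambdaRing.lam n ℓ = 0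

/-- `x` is even (of finite degree): `λ_t(x)` is a polynomial. -/
def IsEvenElement (x : R) : Prop := ∃ d, ∀ n, d < n → LambdaRing.lam n x = 0

/-- `x` is finite-dimensional: a difference of two even elements. -/
def IsFiniteDimElement (x : R) : Prop :=
  ∃ y z : R, IsEvenElement y ∧ IsEvenElement z ∧ x = y - z

end Elements

/-- The partition `(2, 1)`. -/
def hookTwoOne : YoungDiagram := YoungDiagram.ofRowLens [2, 1] (by decide)

/-!
The set `Λ(A) = 1 + t A⟦t⟧` is a `λ`-ring in which every `1 + a t` is a line element, and
`x ↦ λ_t(x) = ∑ λⁿ(x) tⁿ` embeds a `λ`-ring `R` into `Λ(R)`, hence into `Λ(B)` for every extension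
`B` of `R`. Addition in `Λ(R)` is multiplication of power series. By the Jacobi-Trudi formula for
two-column hooks, the bound `(2, 1)` says that `λᵏ⁺²(x) = x λᵏ⁺¹(x)` for `k ≥ 1`, that is, that
`λ_t(x) (1 - x t)` is a polynomial of degree at most two. Over an extension `B` of `R` obtained by
adjoining roots of a monic polynomial it factors as `(1 + a t) (1 + b t)`, and then
`x = (1 + a t) + (1 + b t) - (1 - x t)` in `Λ(B)`.

The operations of `Λ(A)` are given by polynomials in the coefficients, and modulo any power of `t`
every element becomes, over an extension of `A`, a finite product of series `1 + a t`. Identities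
between the operations therefore need only be checked on such products, where they are identities
between elementary symmetric functions.
-/

universe v

theorem elemSymm_one {ι A : Type*} [CommRing A] (s : Finset ι) (f : ι → A) :
    elemSymm s f 1 = ∑ i ∈ s, f i := by
  simp [elemSymm, Finset.powersetCard_one]

theorem elemSymm_eq_zero_of_card_lt {ι A : Type*} [CommRing A] {s : Finset ι} {n : ℕ}
    (h : s.card < n) (f : ι → A) : elemSymm s f n = 0 := by
  rw [elemSymm, Finset.powersetCard_eq_empty.2 h, Finset.sum_empty]

theorem elemSymm_mul_left {ι A : Type*} [CommRing A] (c : A) (s : Finset ι) (f : ι → A) (n : ℕ) :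
    elemSymm s (fun i => c * f i) n = c ^ n * elemSymm s f n := by
  rw [elemSymm, elemSymm, Finset.mul_sum]
  refine Finset.sum_congr rfl fun T hT => ?_
  rw [Finset.prod_mul_distrib, Finset.prod_const, (Finset.mem_powersetCard.1 hT).2]

theorem elemSymm_disjSum {ι κ A : Type*} [CommRing A] (s : Finset ι) (t : Finset κ) (f : ι ⊕ κ → A)
    (n : ℕ) : elemSymm (s.disjSum t) f n = ∑ p ∈ Finset.HasAntidiagonal.antidiagonal n,
      elemSymm s (fun i => f (Sum.inl i)) p.1 * elemSymm t (fun j => f (Sum.inr j)) p.2 := by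
  classical
  simp only [← coeff_prod_one_add, Finset.prod_disjSum, Polynomial.coeff_mul]

theorem map_aeval_int {σ A B : Type*} [CommRing A] [CommRing B] [Algebra ℤ A] [Algebra ℤ B]
    (φ : A →+* B) (f : σ → A) (p : MvPolynomial σ ℤ) :
    φ (MvPolynomial.aeval f p) = MvPolynomial.aeval (fun i => φ (f i)) p :=
  (MvPolynomial.map_aeval f φ p).trans
    (MvPolynomial.eval₂Hom_congr (Subsingleton.elim _ _) rfl rfl)

theorem dvd_aeval_sub_aeval {σ A : Type*} [CommRing A] {d : A} {f g : σ → A}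
    (h : ∀ i, d ∣ f i - g i) (p : MvPolynomial σ ℤ) :
    d ∣ MvPolynomial.aeval f p - MvPolynomial.aeval g p := by
  simp only [← Ideal.mem_span_singleton, ← Ideal.Quotient.mk_eq_mk_iff_sub_mem] at h ⊢
  rw [map_aeval_int, map_aeval_int, funext h]

theorem aeval_congr_of_vars {σ A : Type*} [CommRing A] {f g : σ → A} {p : MvPolynomial σ ℤ}
    (h : ∀ i ∈ p.vars, f i = g i) : MvPolynomial.aeval f p = MvPolynomial.aeval g p :=
  MvPolynomial.eval₂Hom_congr' rfl (fun i hi _ => h i hi) rfl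

section Splitting

open Polynomial

theorem injective_adjoinRoot_of_monic {A : Type*} [CommRing A] {p : A[X]} (hp : p.Monic)
    (h : 0 < p.natDegree) : Function.Injective (AdjoinRoot.of p) := by
  rw [injective_iff_map_eq_zero]
  intro c hc
  rw [← AdjoinRoot.mk_C, AdjoinRoot.mk_eq_zero] at hc
  by_contra hne
  exact hp.not_dvd_of_natDegree_lt (C_ne_zero.2 hne) (by rwa [natDegree_C]) hc

theorem exists_map_eq_prod_X_add_C_of_monic (N : ℕ) {A : Type v} [CommRing A] {p : A[X]}
    (hp : p.Monic) (hN : p.natDegree = N) :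
    ∃ (B : Type v) (_ : CommRing B) (φ : A →+* B), Function.Injective φ ∧
      ∃ a : Fin N → B, p.map φ = ∏ j, (X + C (a j)) := by
  induction N generalizing A with
  | zero =>
    exact ⟨A, inferInstance, RingHom.id A, Function.injective_id, Fin.elim0,
      by simp [hp.natDegree_eq_zero.1 hN]⟩
  | succ N ih =>
    have hof := injective_adjoinRoot_of_monic hp (by omega)
    have : Nontrivial A := Polynomial.nontrivial_iff.1 ⟨p, 0, by rintro rfl; simp at hN⟩
    have : Nontrivial (AdjoinRoot p) := hof.nontrivial
    set r := AdjoinRoot.root p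
    set q := p.map (AdjoinRoot.of p) /ₘ (X - C r)
    have hq : (X - C r) * q = p.map (AdjoinRoot.of p) :=
      mul_divByMonic_eq_iff_isRoot.2 (AdjoinRoot.isRoot_root p)
    have hq_monic : q.Monic := (monic_X_sub_C r).of_mul_monic_left (by rw [hq]; exact hp.map _)
    have hq_deg : q.natDegree = N := by
      rw [natDegree_divByMonic _ (monic_X_sub_C r), hp.natDegree_map, hN, natDegree_X_sub_C,
        Nat.add_sub_cancel]
    obtain ⟨B, _, φ, hφ, a, ha⟩ := ih hq_monic hq_deg
    refine ⟨B, inferInstance, φ.comp (AdjoinRoot.of p), hφ.comp hof, Fin.cons (-φ r) a, ?_⟩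
    rw [← Polynomial.map_map, ← hq, Polynomial.map_mul, ha, Fin.prod_univ_succ]
    simp [sub_eq_add_neg]

theorem exists_elemSymm_eq (N : ℕ) {A : Type v} [CommRing A] (c : ℕ → A) (hc : c 0 = 1) :
    ∃ (B : Type v) (_ : CommRing B) (φ : A →+* B), Function.Injective φ ∧
      ∃ a : Fin N → B, ∀ k ≤ N, elemSymm Finset.univ a k = φ (c k) := by
  rcases subsingleton_or_nontrivial A with _ | _
  · exact ⟨A, inferInstance, RingHom.id A, Function.injective_id, 0,
      fun _ _ => Subsingleton.elim _ _⟩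
  let p : A[X] := ∑ k ∈ Finset.range (N + 1), C (c (N - k)) * X ^ k
  have hp_coeff (k : ℕ) : p.coeff k = if k ≤ N then c (N - k) else 0 := by
    simp [p, finsetSum_coeff]
  have hp_deg : p.natDegree ≤ N :=
    natDegree_le_iff_coeff_eq_zero.2 fun k hk => by rw [hp_coeff, if_neg hk.not_ge]
  have hp_lead : p.coeff N = 1 := by rw [hp_coeff, if_pos le_rfl, Nat.sub_self, hc]
  obtain ⟨B, _, φ, hφ, a, ha⟩ := exists_map_eq_prod_X_add_C_of_monic N
    (monic_of_natDegree_le_of_coeff_eq_one N hp_deg hp_lead)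
    (natDegree_eq_of_le_of_coeff_ne_zero hp_deg (by rw [hp_lead]; exact one_ne_zero))
  refine ⟨B, inferInstance, φ, hφ, a, fun k hk => ?_⟩
  have h := Finset.prod_X_add_C_coeff Finset.univ a (k := N - k) (by simp)
  rw [← ha, coeff_map, hp_coeff, if_pos (Nat.sub_le N k), Finset.card_fin,
    Nat.sub_sub_self hk] at h
  exact h.symm

end Splitting

section Plethysm

variable {ι κ A B : Type*} [CommRing A] [CommRing B]

theorem elemSymm_map (e : ι ↪ κ) (s : Finset ι) (f : κ → A) (n : ℕ) :
    elemSymm (s.map e) f n = elemSymm s (fun i => f (e i)) n := by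
  simp [elemSymm, Finset.powersetCard_map]

theorem elemSymm_eq_of_subset {s t : Finset ι} (h : s ⊆ t) {f : ι → A}
    (hf : ∀ i ∈ t, i ∉ s → f i = 0) (n : ℕ) : elemSymm s f n = elemSymm t f n := by
  refine Finset.sum_subset (Finset.powersetCard_mono h) fun T hT hTs => ?_
  obtain ⟨hTt, hT_card⟩ := Finset.mem_powersetCard.1 hT
  obtain ⟨i, hiT, his⟩ := Finset.not_subset.1 fun hTs' =>
    hTs (Finset.mem_powersetCard.2 ⟨hTs', hT_card⟩)
  exact Finset.prod_eq_zero hiT (hf i (hTt hiT) his)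

/-- The value at the family `(f i)_{i ∈ s}` of the plethysm `e_m[e_n]`: the elementary symmetric
polynomial of degree `m` of the products of `n` members of the family. -/
def elemPlethysm (m n : ℕ) (s : Finset ι) (f : ι → A) : A :=
  elemSymm (s.powersetCard n) (fun S => ∏ i ∈ S, f i) m

theorem map_elemPlethysm (φ : A →+* B) (m n : ℕ) (s : Finset ι) (f : ι → A) :
    φ (elemPlethysm m n s f) = elemPlethysm m n s (fun i => φ (f i)) := by
  simp only [elemPlethysm, map_elemSymm, map_prod]

theorem elemPlethysm_map (m n : ℕ) (e : ι ↪ κ) (s : Finset ι) (f : κ → A) :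
    elemPlethysm m n (s.map e) f = elemPlethysm m n s (fun i => f (e i)) := by
  simp [elemPlethysm, Finset.powersetCard_map, elemSymm_map]

theorem elemPlethysm_eq_of_subset (m n : ℕ) {s t : Finset ι} (h : s ⊆ t) {f : ι → A}
    (hf : ∀ i ∈ t, i ∉ s → f i = 0) : elemPlethysm m n s f = elemPlethysm m n t f := by
  refine elemSymm_eq_of_subset (Finset.powersetCard_mono h) (fun S hS hSs => ?_) m
  obtain ⟨hSt, hS_card⟩ := Finset.mem_powersetCard.1 hS
  obtain ⟨i, hiS, his⟩ := Finset.not_subset.1 fun hSs' =>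
    hSs (Finset.mem_powersetCard.2 ⟨hSs', hS_card⟩)
  exact Finset.prod_eq_zero hiS (hf i (hSt hiS) his)

theorem elemPlethysm_mul_left (m n : ℕ) (c : A) (s : Finset ι) (f : ι → A) :
    elemPlethysm m n s (fun i => c * f i) = c ^ (m * n) * elemPlethysm m n s f := by
  rw [elemPlethysm, elemPlethysm, mul_comm m n, pow_mul, ← elemSymm_mul_left]
  refine Finset.sum_congr rfl fun T hT => Finset.prod_congr rfl fun S hS => ?_
  have hS_card := (Finset.mem_powersetCard.1 ((Finset.mem_powersetCard.1 hT).1 hS)).2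
  simp only [Finset.prod_mul_distrib, Finset.prod_const, hS_card]

theorem aeval_elemSymm_eq_elemPlethysm [Fintype ι] {N m n : ℕ} {Q : MvPolynomial (Fin N) ℤ}
    (hQ : MvPolynomial.aeval (fun k : Fin N => elemSymm Finset.univ
      (MvPolynomial.X : ι → MvPolynomial ι ℤ) (k + 1)) Q =
        elemPlethysm m n Finset.univ (MvPolynomial.X : ι → MvPolynomial ι ℤ)) (f : ι → A) :
    MvPolynomial.aeval (fun k : Fin N => elemSymm Finset.univ f (k + 1)) Q =
      elemPlethysm m n Finset.univ f := by
  have h := congrArg (MvPolynomial.aeval f : MvPolynomial ι ℤ →ₐ[ℤ] A).toRingHom hQ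
  rw [map_aeval_int, map_elemPlethysm] at h
  simpa [map_elemSymm] using h

theorem exists_aeval_eq_elemPlethysm (m n : ℕ) (s : Finset ι) :
    ∃ Q : MvPolynomial (Fin s.card) ℤ, ∀ f : ι → A,
      MvPolynomial.aeval (fun k : Fin s.card => elemSymm s f (k + 1)) Q = elemPlethysm m n s f := by
  obtain ⟨Q, hQ⟩ := MvPolynomial.esymmAlgHom_surjective (σ := s) ℤ (Fintype.card_coe s).le
    ⟨elemPlethysm m n Finset.univ MvPolynomial.X, rename_elemSymm_powersetCard m n⟩
  refine ⟨Q, fun f => ?_⟩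
  have h := aeval_elemSymm_eq_elemPlethysm
    ((MvPolynomial.esymmAlgHom_apply ..).symm.trans (congrArg Subtype.val hQ)) fun i : s => f i
  have hs : Finset.univ.map (.subtype (· ∈ s)) = s := s.attach_map_val
  simpa only [← Function.Embedding.subtype_apply, ← elemSymm_map, ← elemPlethysm_map, hs] using h

open Polynomial in
theorem elemPlethysm_congr_of_forall_elemSymm_eq {m n : ℕ} (s : Finset ι) {f g : ι → A}
    (h : ∀ k ≤ m * n, elemSymm s f k = elemSymm s g k) :
    elemPlethysm m n s f = elemPlethysm m n s g := by
  obtain ⟨Q, hQ⟩ := exists_aeval_eq_elemPlethysm (A := A[X]) m n s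
  -- Give each variable the weight one, that is, replace it by its product with `X`.
  have h_elemSymm (f : ι → A) (k : ℕ) :
      elemSymm s (fun i => X * C (f i)) k = X ^ k * C (elemSymm s f k) := by
    rw [elemSymm_mul_left, map_elemSymm]
  have h_elemPlethysm (f : ι → A) :
      elemPlethysm m n s (fun i => X * C (f i)) = X ^ (m * n) * C (elemPlethysm m n s f) := by
    rw [elemPlethysm_mul_left, map_elemPlethysm]
  have h_dvd : X ^ (m * n + 1) ∣
      X ^ (m * n) * C (elemPlethysm m n s f) - X ^ (m * n) * C (elemPlethysm m n s g) := by
    rw [← h_elemPlethysm, ← h_elemPlethysm, ← hQ, ← hQ]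
    refine dvd_aeval_sub_aeval (fun k => ?_) Q
    rw [h_elemSymm, h_elemSymm, ← mul_sub, ← C_sub]
    by_cases hk : (k : ℕ) + 1 ≤ m * n
    · rw [h _ hk, sub_self, C_0, mul_zero]
      exact dvd_zero _
    · exact (pow_dvd_pow X (by omega)).mul_right _
  simpa [sub_eq_zero] using X_pow_dvd_iff.1 h_dvd (m * n) (Nat.lt_succ_self _)

theorem elemPlethysm_congr {m n : ℕ} {s : Finset ι} {t : Finset κ} {f : ι → A} {g : κ → A}
    (h : ∀ k ≤ m * n, elemSymm s f k = elemSymm t g k) :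
    elemPlethysm m n s f = elemPlethysm m n t g := by
  have hl : s.map .inl ⊆ s.disjSum t := Finset.map_inl_subset_iff_subset_toLeft.2 (by simp)
  have hr : t.map .inr ⊆ s.disjSum t := Finset.map_inr_subset_iff_subset_toRight.2 (by simp)
  have hf : ∀ i ∈ s.disjSum t, i ∉ s.map .inl → Sum.elim f (0 : κ → A) i = 0 := by
    rintro (i | j) <;> simp_all
  have hg : ∀ i ∈ s.disjSum t, i ∉ t.map .inr → Sum.elim (0 : ι → A) g i = 0 := by
    rintro (i | j) <;> simp_all
  have h' := elemPlethysm_congr_of_forall_elemSymm_eq (m := m) (n := n) (s.disjSum t)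
    (f := Sum.elim f 0) (g := Sum.elim 0 g) fun k hk => by
      rw [← elemSymm_eq_of_subset hl hf, ← elemSymm_eq_of_subset hr hg, elemSymm_map, elemSymm_map]
      exact h k hk
  rwa [← elemPlethysm_eq_of_subset m n hl hf, ← elemPlethysm_eq_of_subset m n hr hg,
    elemPlethysm_map, elemPlethysm_map] at h'

theorem aeval_compPoly_elemSymm (m n : ℕ) (s : Finset ι) (f : ι → A) :
    MvPolynomial.aeval (fun k : Fin (m * n) => elemSymm s f (k + 1)) (compPoly m n) =
      elemPlethysm m n s f := by
  obtain ⟨B, _, φ, hφ, g, hg⟩ := exists_elemSymm_eq (m * n) (elemSymm s f) (elemSymm_zero s f)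
  apply hφ
  have h (k) (hk : k ≤ m * n) : elemSymm Finset.univ g k = elemSymm s (fun i => φ (f i)) k := by
    rw [hg k hk, map_elemSymm]
  rw [map_aeval_int, map_elemPlethysm, ← elemPlethysm_congr h,
    ← aeval_elemSymm_eq_elemPlethysm (isCompPoly_compPoly m n) g]
  congr! 2
  exact funext fun k => (hg _ k.2).symm

end Plethysm

/-- The group `Λ(A) = 1 + t A⟦t⟧` of power series with constant coefficient `1`, written additively:
the sum of two elements is the product of the power series. It carries the universal `λ`-ring
structure over `A`. -/
@[ext]
structure LambdaSeries (A : Type*) [CommRing A] where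
  /-- The underlying power series. -/
  toPowerSeries : PowerSeries A
  constantCoeff_eq_one : PowerSeries.constantCoeff toPowerSeries = 1

namespace LambdaSeries

noncomputable section

section AdditiveGroup

variable {ι A B : Type*} [CommRing A] [CommRing B]

/-- The coefficient of `tⁿ`. -/
def coeff (f : LambdaSeries A) (n : ℕ) : A := PowerSeries.coeff n f.toPowerSeries

@[simp]
theorem coeff_zero (f : LambdaSeries A) : f.coeff 0 = 1 := by
  rw [coeff, PowerSeries.coeff_zero_eq_constantCoeff_apply, f.constantCoeff_eq_one]

theorem ext_coeff {f g : LambdaSeries A} (h : ∀ n, f.coeff n = g.coeff n) : f = g :=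
  LambdaSeries.ext (PowerSeries.ext h)

/-- The power series with coefficients `c n`. -/
def ofCoeff (c : ℕ → A) (hc : c 0 = 1) : LambdaSeries A where
  toPowerSeries := PowerSeries.mk c
  constantCoeff_eq_one := by
    rw [← PowerSeries.coeff_zero_eq_constantCoeff_apply, PowerSeries.coeff_mk, hc]

@[simp]
theorem coeff_ofCoeff (c : ℕ → A) (hc : c 0 = 1) (n : ℕ) : (ofCoeff c hc).coeff n = c n :=
  PowerSeries.coeff_mk n c

instance : Zero (LambdaSeries A) := ⟨⟨1, map_one _⟩⟩

instance : Add (LambdaSeries A) :=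
  ⟨fun f g => ⟨f.toPowerSeries * g.toPowerSeries, by
    rw [map_mul, f.constantCoeff_eq_one, g.constantCoeff_eq_one, one_mul]⟩⟩

instance : Neg (LambdaSeries A) :=
  ⟨fun f => ⟨PowerSeries.invOfUnit f.toPowerSeries 1, by simp⟩⟩

instance : AddCommGroup (LambdaSeries A) where
  add_assoc f g h := LambdaSeries.ext (mul_assoc _ _ _)
  zero_add f := LambdaSeries.ext (one_mul _)
  add_zero f := LambdaSeries.ext (mul_one _)
  add_comm f g := LambdaSeries.ext (mul_comm _ _)
  neg_add_cancel f := LambdaSeries.ext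
    (PowerSeries.invOfUnit_mul f.toPowerSeries 1 f.constantCoeff_eq_one)
  nsmul := nsmulRec
  zsmul := zsmulRec

theorem coeff_add (f g : LambdaSeries A) (n : ℕ) : (f + g).coeff n =
    ∑ p ∈ Finset.HasAntidiagonal.antidiagonal n, f.coeff p.1 * g.coeff p.2 :=
  PowerSeries.coeff_mul n _ _

theorem toPowerSeries_sum (s : Finset ι) (f : ι → LambdaSeries A) :
    (∑ i ∈ s, f i).toPowerSeries = ∏ i ∈ s, (f i).toPowerSeries := by
  classical
  induction s using Finset.induction_on with
  | empty => rfl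
  | insert i s hi ih =>
    rw [Finset.sum_insert hi, Finset.prod_insert hi, ← ih]
    rfl

/-- The series `1 + a t`. It is a line element of `Λ(A)`. -/
def teichmuller (a : A) : LambdaSeries A :=
  ⟨1 + PowerSeries.C a * PowerSeries.X, by simp⟩

theorem coeff_sum_teichmuller (s : Finset ι) (a : ι → A) (n : ℕ) :
    (∑ i ∈ s, teichmuller (a i)).coeff n = elemSymm s a n := by
  classical
  have h : ∏ i ∈ s, (teichmuller (a i)).toPowerSeries =
      Polynomial.coeToPowerSeries.ringHom
        (∏ i ∈ s, (1 + Polynomial.C (a i) * Polynomial.X)) := by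
    simp [teichmuller]
  rw [← coeff_prod_one_add, ← Polynomial.coeff_coe, ← Polynomial.coeToPowerSeries.ringHom_apply,
    ← h, ← toPowerSeries_sum, coeff]

/-- The homomorphism `Λ(A) → Λ(B)` that applies `φ : A → B` to the coefficients. -/
def map (φ : A →+* B) : LambdaSeries A →+ LambdaSeries B where
  toFun f := ⟨PowerSeries.map φ f.toPowerSeries, by
    rw [← PowerSeries.coeff_zero_eq_constantCoeff_apply, PowerSeries.coeff_map,
      PowerSeries.coeff_zero_eq_constantCoeff_apply, f.constantCoeff_eq_one, map_one]⟩
  map_zero' := LambdaSeries.ext (map_one _)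
  map_add' _ _ := LambdaSeries.ext (map_mul _ _ _)

@[simp]
theorem coeff_map (φ : A →+* B) (f : LambdaSeries A) (n : ℕ) :
    (map φ f).coeff n = φ (f.coeff n) :=
  PowerSeries.coeff_map φ n _

theorem map_comp {C : Type*} [CommRing C] (ψ : B →+* C) (φ : A →+* B) (f : LambdaSeries A) :
    map (ψ.comp φ) f = map ψ (map φ f) :=
  ext_coeff fun n => by simp

@[simp]
theorem map_teichmuller (φ : A →+* B) (a : A) : map φ (teichmuller a) = teichmuller (φ a) :=
  LambdaSeries.ext (by simp [map, teichmuller])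

/-- `f` and `g` have the same coefficients in degrees up to `N`. -/
def EqUpTo (N : ℕ) (f g : LambdaSeries A) : Prop := ∀ k ≤ N, f.coeff k = g.coeff k

namespace EqUpTo

variable {N : ℕ} {f f' g g' : LambdaSeries A}

theorem add (hf : EqUpTo N f f') (hg : EqUpTo N g g') : EqUpTo N (f + g) (f' + g') := by
  intro k hk
  rw [coeff_add, coeff_add]
  refine Finset.sum_congr rfl fun p hp => ?_
  have hp_add := Finset.HasAntidiagonal.mem_antidiagonal.1 hp
  rw [hf _ (by lia), hg _ (by lia)]

theorem map (h : EqUpTo N f g) (φ : A →+* B) :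
    EqUpTo N (LambdaSeries.map φ f) (LambdaSeries.map φ g) := fun k hk => by
  rw [coeff_map, coeff_map, h k hk]

theorem sum_teichmuller_mul {κ μ : Type*} {s : Finset ι} {t : Finset κ} {u : Finset μ}
    {b : κ → A} {c : μ → A}
    (h : EqUpTo N (∑ j ∈ t, teichmuller (b j)) (∑ k ∈ u, teichmuller (c k))) (a : ι → A) :
    EqUpTo N (∑ i ∈ s, ∑ j ∈ t, teichmuller (a i * b j))
      (∑ i ∈ s, ∑ k ∈ u, teichmuller (a i * c k)) := by
  refine Finset.sum_hom_rel (fun _ _ => rfl) fun i _ _ => add fun k hk => ?_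
  rw [coeff_sum_teichmuller, coeff_sum_teichmuller, elemSymm_mul_left, elemSymm_mul_left,
    ← coeff_sum_teichmuller, ← coeff_sum_teichmuller, h k hk]

theorem sum_teichmuller_mul_teichmuller {κ ι' κ' : Type*} {s : Finset ι} {s' : Finset ι'}
    {t : Finset κ} {t' : Finset κ'} {a : ι → A} {a' : ι' → A} {b : κ → A} {b' : κ' → A}
    (ha : EqUpTo N (∑ i ∈ s, teichmuller (a i)) (∑ i ∈ s', teichmuller (a' i)))
    (hb : EqUpTo N (∑ j ∈ t, teichmuller (b j)) (∑ j ∈ t', teichmuller (b' j))) :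
    EqUpTo N (∑ i ∈ s, ∑ j ∈ t, teichmuller (a i * b j))
      (∑ i ∈ s', ∑ j ∈ t', teichmuller (a' i * b' j)) := by
  intro k hk
  rw [hb.sum_teichmuller_mul a k hk, Finset.sum_comm, Finset.sum_comm (s := s')]
  simp only [mul_comm _ (b' _)]
  exact ha.sum_teichmuller_mul b' k hk

end EqUpTo

end AdditiveGroup

theorem exists_eqUpTo_sum_teichmuller {ι : Type*} [Finite ι] {A : Type v} [CommRing A] (N : ι → ℕ)
    (f : ι → LambdaSeries A) :
    ∃ (B : Type v) (_ : CommRing B) (φ : A →+* B), Function.Injective φ ∧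
      ∃ b : ∀ i, Fin (N i) → B, ∀ i, EqUpTo (N i) (map φ (f i)) (∑ j, teichmuller (b i j)) := by
  classical
  have h (s : Finset ι) : ∃ (B : Type v) (_ : CommRing B) (φ : A →+* B), Function.Injective φ ∧
      ∀ i ∈ s, ∃ b : Fin (N i) → B, EqUpTo (N i) (map φ (f i)) (∑ j, teichmuller (b j)) := by
    induction s using Finset.induction_on with
    | empty => exact ⟨A, inferInstance, RingHom.id A, Function.injective_id, by simp⟩
    | insert i s _ ih =>
      obtain ⟨B, _, φ, hφ, hs⟩ := ih
      obtain ⟨C, _, ψ, hψ, c, hc⟩ :=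
        exists_elemSymm_eq (N i) (map φ (f i)).coeff (coeff_zero _)
      refine ⟨C, inferInstance, ψ.comp φ, hψ.comp hφ, Finset.forall_mem_insert _ _ _ |>.2
        ⟨⟨c, fun k hk => ?_⟩, fun j hj => ?_⟩⟩
      · rw [map_comp, coeff_map, coeff_sum_teichmuller, hc k hk]
      · obtain ⟨b, hb⟩ := hs j hj
        refine ⟨fun l => ψ (b l), ?_⟩
        simpa only [map_comp, map_sum, map_teichmuller] using hb.map ψ
  have := Fintype.ofFinite ι
  obtain ⟨B, _, φ, hφ, hB⟩ := h Finset.univ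
  choose b hb using fun i => hB i (Finset.mem_univ i)
  exact ⟨B, inferInstance, φ, hφ, b, hb⟩

end

end LambdaSeries

section MulPoly

variable {ι κ A : Type*} [CommRing A]

theorem aeval_mulPoly_elemSymm_univ {n : ℕ} (a b : Fin n → A) :
    MvPolynomial.aeval (Sum.elim (fun i : Fin n => elemSymm Finset.univ a (i + 1))
      (fun j : Fin n => elemSymm Finset.univ b (j + 1))) (mulPoly n) =
    elemSymm Finset.univ (fun c : Fin n × Fin n => a c.1 * b c.2) n := by
  have h := congrArg (MvPolynomial.aeval (Sum.elim a b) : MvPolynomial _ ℤ →ₐ[ℤ] A).toRingHom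
    (isMulPoly_mulPoly n)
  rw [map_aeval_int, map_elemSymm] at h
  convert h using 2
  · congr 1
    ext (i | j) <;> simp [map_elemSymm]
  · simp

open LambdaSeries in
theorem aeval_mulPoly_elemSymm (n : ℕ) (s : Finset ι) (t : Finset κ) (a : ι → A) (b : κ → A) :
    MvPolynomial.aeval (Sum.elim (fun i : Fin n => elemSymm s a (i + 1))
      (fun j : Fin n => elemSymm t b (j + 1))) (mulPoly n) =
    elemSymm (s ×ˢ t) (fun c => a c.1 * b c.2) n := by
  obtain ⟨B, _, φ, hφ, c, hc⟩ := exists_eqUpTo_sum_teichmuller (fun _ : Fin 2 => n)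
    ![∑ i ∈ s, teichmuller (a i), ∑ j ∈ t, teichmuller (b j)]
  have ha : EqUpTo n (∑ i ∈ s, teichmuller (φ (a i))) (∑ k, teichmuller (c 0 k)) := by
    simpa using hc 0
  have hb : EqUpTo n (∑ j ∈ t, teichmuller (φ (b j))) (∑ k, teichmuller (c 1 k)) := by
    simpa using hc 1
  have hab := ha.sum_teichmuller_mul_teichmuller hb n le_rfl
  rw [← Finset.sum_product', ← Finset.sum_product', coeff_sum_teichmuller, coeff_sum_teichmuller,
    Finset.univ_product_univ, ← aeval_mulPoly_elemSymm_univ] at hab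
  apply hφ
  rw [map_aeval_int, map_elemSymm]
  simp only [map_mul]
  rw [hab]
  congr 2
  funext i
  rcases i with i | j
  · simpa [coeff_sum_teichmuller, map_elemSymm] using ha _ i.2
  · simpa [coeff_sum_teichmuller, map_elemSymm] using hb _ j.2

theorem aeval_mulPoly_zero (f : Fin 0 ⊕ Fin 0 → A) :
    MvPolynomial.aeval f (mulPoly 0) = 1 := by
  rw [← elemSymm_zero ((∅ : Finset ℕ) ×ˢ (∅ : Finset ℕ)) fun c => (0 : A) * 0,
    ← aeval_mulPoly_elemSymm 0 _ _ (fun _ => (0 : A)) (fun _ => (0 : A))]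
  congr 2
  exact Subsingleton.elim _ _

theorem aeval_compPoly_zero_left (n : ℕ) (f : Fin (0 * n) → A) :
    MvPolynomial.aeval f (compPoly 0 n) = 1 := by
  have : IsEmpty (Fin (0 * n)) := by rw [zero_mul]; infer_instance
  rw [← elemSymm_zero ((∅ : Finset ℕ).powersetCard n) fun S => ∏ _i ∈ S, (0 : A),
    ← elemPlethysm, ← aeval_compPoly_elemSymm]
  congr 2
  exact Subsingleton.elim _ _

end MulPoly

namespace LambdaSeries

noncomputable section

section Operations

variable {ι κ A B : Type*} [CommRing A] [CommRing B]

instance : One (LambdaSeries A) := ⟨teichmuller 1⟩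

instance : Mul (LambdaSeries A) :=
  ⟨fun f g => ofCoeff (fun n => MvPolynomial.aeval (Sum.elim (fun i : Fin n => f.coeff (i + 1))
    (fun j : Fin n => g.coeff (j + 1))) (mulPoly n)) (aeval_mulPoly_zero _)⟩

/-- The operation `λⁿ` on `Λ(A)`. -/
def lam (n : ℕ) (f : LambdaSeries A) : LambdaSeries A :=
  ofCoeff (fun m => MvPolynomial.aeval (fun i : Fin (m * n) => f.coeff (i + 1)) (compPoly m n))
    (aeval_compPoly_zero_left n _)

theorem coeff_mul (f g : LambdaSeries A) (n : ℕ) : (f * g).coeff n =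
    MvPolynomial.aeval (Sum.elim (fun i : Fin n => f.coeff (i + 1))
      (fun j : Fin n => g.coeff (j + 1))) (mulPoly n) :=
  coeff_ofCoeff _ _ n

theorem coeff_lam (n : ℕ) (f : LambdaSeries A) (m : ℕ) : (lam n f).coeff m =
    MvPolynomial.aeval (fun i : Fin (m * n) => f.coeff (i + 1)) (compPoly m n) :=
  coeff_ofCoeff _ _ m

theorem map_mul' (φ : A →+* B) (f g : LambdaSeries A) : map φ (f * g) = map φ f * map φ g :=
  ext_coeff fun n => by
    rw [coeff_map, coeff_mul, coeff_mul, map_aeval_int]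
    congr! 2
    funext i
    rcases i with i | j <;> simp

theorem map_lam (φ : A →+* B) (n : ℕ) (f : LambdaSeries A) : map φ (lam n f) = lam n (map φ f) :=
  ext_coeff fun m => by simp only [coeff_map, coeff_lam, map_aeval_int]

theorem sum_teichmuller_add_sum_teichmuller (s : Finset ι) (t : Finset κ) (a : ι → A) (b : κ → A) :
    ∑ i ∈ s, teichmuller (a i) + ∑ j ∈ t, teichmuller (b j) =
      ∑ c ∈ s.disjSum t, teichmuller (Sum.elim a b c) := by
  simp [Finset.sum_disjSum]

theorem sum_teichmuller_mul_sum_teichmuller (s : Finset ι) (t : Finset κ) (a : ι → A) (b : κ → A) :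
    (∑ i ∈ s, teichmuller (a i)) * ∑ j ∈ t, teichmuller (b j) =
      ∑ c ∈ s ×ˢ t, teichmuller (a c.1 * b c.2) :=
  ext_coeff fun n => by simp only [coeff_mul, coeff_sum_teichmuller, aeval_mulPoly_elemSymm]

theorem lam_sum_teichmuller (n : ℕ) (s : Finset ι) (a : ι → A) :
    lam n (∑ i ∈ s, teichmuller (a i)) = ∑ S ∈ s.powersetCard n, teichmuller (∏ i ∈ S, a i) :=
  ext_coeff fun m => by
    simp only [coeff_lam, coeff_sum_teichmuller, aeval_compPoly_elemSymm, elemPlethysm]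

theorem teichmuller_mul (a b : A) : teichmuller (a * b) = teichmuller a * teichmuller b := by
  simpa using (sum_teichmuller_mul_sum_teichmuller {()} {()} (fun _ => a) (fun _ => b)).symm

end Operations

section PolynomialOperation

variable {ι : Type*}

/-- An operation on families of elements of `Λ(B)`, defined for all rings `B`, is polynomial if the
coefficients of its value are polynomials, with integer coefficients that do not depend on `B`, in
the coefficients of its arguments. -/
def IsPolynomialOperation
    (F : ∀ (B : Type v) [CommRing B], (ι → LambdaSeries B) → LambdaSeries B) : Prop :=
  ∃ P : ℕ → MvPolynomial (ι × ℕ) ℤ, ∀ (B : Type v) [CommRing B] (f : ι → LambdaSeries B) (n : ℕ),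
    (F B f).coeff n = MvPolynomial.aeval (fun p => (f p.1).coeff p.2) (P n)

namespace IsPolynomialOperation

variable {F G : ∀ (B : Type v) [CommRing B], (ι → LambdaSeries B) → LambdaSeries B}

theorem proj (i : ι) : IsPolynomialOperation fun (B : Type v) _ (f : ι → LambdaSeries B) => f i :=
  ⟨fun n => MvPolynomial.X (i, n), fun _ _ _ _ => by rw [MvPolynomial.aeval_X]⟩

theorem map_intCast (c : LambdaSeries ℤ) : IsPolynomialOperation
    fun (B : Type v) _ (_ : ι → LambdaSeries B) => map (Int.castRingHom B) c :=
  ⟨fun n => MvPolynomial.C (c.coeff n), fun _ _ _ _ => by simp⟩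

theorem one : IsPolynomialOperation fun (B : Type v) _ (_ : ι → LambdaSeries B) => 1 := by
  obtain ⟨P, hP⟩ := map_intCast (ι := ι) (teichmuller 1)
  exact ⟨P, fun B _ f n => by
    rw [← hP]
    simp only [map_teichmuller, map_one]
    rfl⟩

theorem add (hF : IsPolynomialOperation F) (hG : IsPolynomialOperation G) :
    IsPolynomialOperation fun B _ f => F B f + G B f := by
  obtain ⟨P, hP⟩ := hF
  obtain ⟨Q, hQ⟩ := hG
  exact ⟨fun n => ∑ p ∈ Finset.HasAntidiagonal.antidiagonal n, P p.1 * Q p.2,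
    fun B _ f n => by simp only [coeff_add, hP, hQ, map_sum, map_mul]⟩

theorem sum {κ : Type*} {s : Finset κ}
    {F : κ → ∀ (B : Type v) [CommRing B], (ι → LambdaSeries B) → LambdaSeries B}
    (hF : ∀ k, IsPolynomialOperation (F k)) :
    IsPolynomialOperation fun B _ f => ∑ k ∈ s, F k B f := by
  classical
  induction s using Finset.induction_on with
  | empty => simpa only [Finset.sum_empty, map_zero] using map_intCast (ι := ι) 0
  | insert k s hk ih => simpa only [Finset.sum_insert hk] using (hF k).add ih

theorem mul (hF : IsPolynomialOperation F) (hG : IsPolynomialOperation G) :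
    IsPolynomialOperation fun B _ f => F B f * G B f := by
  obtain ⟨P, hP⟩ := hF
  obtain ⟨Q, hQ⟩ := hG
  refine ⟨fun n => MvPolynomial.bind₁ (Sum.elim (fun i : Fin n => P (i + 1))
    (fun j : Fin n => Q (j + 1))) (mulPoly n), fun B _ f n => ?_⟩
  rw [coeff_mul, MvPolynomial.aeval_bind₁]
  congr! 2
  funext i
  rcases i with i | j <;> simp [hP, hQ]

theorem lam (hF : IsPolynomialOperation F) (n : ℕ) :
    IsPolynomialOperation fun B _ f => (F B f).lam n := by
  obtain ⟨P, hP⟩ := hF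
  exact ⟨fun m => MvPolynomial.bind₁ (fun i : Fin (m * n) => P (i + 1)) (compPoly m n),
    fun B _ f m => by simp only [coeff_lam, MvPolynomial.aeval_bind₁, hP]⟩

theorem eq_of_forall_sum_teichmuller [Finite ι] (hF : IsPolynomialOperation F)
    (hG : IsPolynomialOperation G)
    (h : ∀ (B : Type v) [CommRing B] (N : ℕ) (a : ι → Fin N → B),
      F B (fun i => ∑ j, teichmuller (a i j)) = G B (fun i => ∑ j, teichmuller (a i j)))
    {A : Type v} [CommRing A] (f : ι → LambdaSeries A) : F A f = G A f := by
  classical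
  obtain ⟨P, hP⟩ := hF
  obtain ⟨Q, hQ⟩ := hG
  refine ext_coeff fun n => ?_
  obtain ⟨N, hN⟩ := (((P n).vars ∪ (Q n).vars).image Prod.snd).exists_le
  obtain ⟨B, _, φ, hφ, b, hb⟩ := exists_eqUpTo_sum_teichmuller (fun _ => N) f
  have h_congr (R : MvPolynomial (ι × ℕ) ℤ) (hR : R.vars ⊆ (P n).vars ∪ (Q n).vars) :
      φ (MvPolynomial.aeval (fun p => (f p.1).coeff p.2) R) =
        MvPolynomial.aeval (fun p => (∑ j, teichmuller (b p.1 j)).coeff p.2) R := by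
    rw [map_aeval_int]
    refine aeval_congr_of_vars fun p hp => ?_
    rw [← coeff_map]
    exact hb _ _ (hN _ (Finset.mem_image_of_mem _ (hR hp)))
  apply hφ
  rw [hP, hQ, h_congr _ Finset.subset_union_left, h_congr _ Finset.subset_union_right,
    ← hP B (fun i => ∑ j, teichmuller (b i j)), ← hQ B (fun i => ∑ j, teichmuller (b i j)), h]

end IsPolynomialOperation

end PolynomialOperation

section CommRing

variable {A : Type v} [CommRing A]

open IsPolynomialOperation

instance : CommRing (LambdaSeries A) :=
  have mul_comm (f g : LambdaSeries A) : f * g = g * f :=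
    eq_of_forall_sum_teichmuller ((proj 0).mul (proj 1)) ((proj 1).mul (proj 0))
      (fun B _ N a => by
        rw [sum_teichmuller_mul_sum_teichmuller, sum_teichmuller_mul_sum_teichmuller,
          Finset.sum_product, Finset.sum_product_right]
        simp only [mul_comm]) ![f, g]
  have mul_add (f g h : LambdaSeries A) : f * (g + h) = f * g + f * h :=
    eq_of_forall_sum_teichmuller ((proj 0).mul ((proj 1).add (proj 2)))
      (((proj 0).mul (proj 1)).add ((proj 0).mul (proj 2)))
      (fun B _ N a => by
        simp only [sum_teichmuller_add_sum_teichmuller, sum_teichmuller_mul_sum_teichmuller]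
        simp only [Finset.sum_product, Finset.sum_disjSum, Finset.sum_add_distrib, Sum.elim_inl,
          Sum.elim_inr]) ![f, g, h]
  have one_mul (f : LambdaSeries A) : 1 * f = f :=
    eq_of_forall_sum_teichmuller (one.mul (proj 0)) (proj 0)
      (fun B _ N a => by
        simpa [Finset.sum_product] using!
          sum_teichmuller_mul_sum_teichmuller {()} Finset.univ (fun _ => 1) (a 0)) ![f]
  have zero_mul (f : LambdaSeries A) : 0 * f = 0 := by
    rw [← add_eq_right, mul_comm, ← mul_add, add_zero]
  { (inferInstance : AddCommGroup (LambdaSeries A)) with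
    left_distrib := mul_add
    right_distrib f g h := by rw [mul_comm, mul_add, mul_comm h, mul_comm h]
    zero_mul
    mul_zero f := by rw [mul_comm, zero_mul]
    mul_assoc f g h :=
      eq_of_forall_sum_teichmuller (((proj 0).mul (proj 1)).mul (proj 2))
        ((proj 0).mul ((proj 1).mul (proj 2)))
        (fun B _ N a => by
          simp only [sum_teichmuller_mul_sum_teichmuller]
          simp only [Finset.sum_product, mul_assoc])
        ![f, g, h]
    one_mul
    mul_one f := by rw [mul_comm, one_mul]
    mul_comm }

end CommRing

section LambdaRing

variable {ι κ : Type*} {A : Type v} [CommRing A]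

/-- The ring homomorphism `Λ(A) → Λ(B)` induced by `φ : A → B`. -/
def mapRingHom {A B : Type*} [CommRing A] [CommRing B] (φ : A →+* B) :
    LambdaSeries A →+* LambdaSeries B :=
  { map φ with
    map_one' := by
      change map φ (teichmuller 1) = teichmuller 1
      rw [map_teichmuller, map_one]
    map_mul' := map_mul' φ }

/-- `a ↦ 1 + a t` as a multiplicative map. -/
def teichmullerHom (A : Type v) [CommRing A] : A →* LambdaSeries A where
  toFun := teichmuller
  map_one' := rfl
  map_mul' := teichmuller_mul

theorem teichmuller_prod (s : Finset ι) (a : ι → A) :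
    teichmuller (∏ i ∈ s, a i) = ∏ i ∈ s, teichmuller (a i) :=
  map_prod (teichmullerHom A) a s

theorem lam_sum_teichmuller_eq_elemSymm (n : ℕ) (s : Finset ι) (a : ι → A) :
    lam n (∑ i ∈ s, teichmuller (a i)) = elemSymm s (fun i => teichmuller (a i)) n := by
  simp only [lam_sum_teichmuller, teichmuller_prod, elemSymm]

theorem lam_sum_teichmuller_eq_zero {n : ℕ} {s : Finset ι} (h : s.card < n) (a : ι → A) :
    lam n (∑ i ∈ s, teichmuller (a i)) = 0 := by
  rw [lam_sum_teichmuller_eq_elemSymm, elemSymm_eq_zero_of_card_lt h]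

theorem lam_sum_teichmuller_mul_sum_teichmuller (n : ℕ) (s : Finset ι) (t : Finset κ)
    (a : ι → A) (b : κ → A) :
    lam n ((∑ i ∈ s, teichmuller (a i)) * ∑ j ∈ t, teichmuller (b j)) =
      MvPolynomial.aeval (Sum.elim (fun i : Fin n => lam (i + 1) (∑ i ∈ s, teichmuller (a i)))
        (fun j : Fin n => lam (j + 1) (∑ j ∈ t, teichmuller (b j)))) (mulPoly n) := by
  rw [sum_teichmuller_mul_sum_teichmuller, lam_sum_teichmuller_eq_elemSymm]
  simp only [lam_sum_teichmuller_eq_elemSymm, teichmuller_mul, aeval_mulPoly_elemSymm]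

theorem lam_lam_sum_teichmuller (m n : ℕ) (s : Finset ι) (a : ι → A) :
    lam m (lam n (∑ i ∈ s, teichmuller (a i))) =
      MvPolynomial.aeval (fun i : Fin (m * n) => lam (i + 1) (∑ i ∈ s, teichmuller (a i)))
        (compPoly m n) := by
  rw [lam_sum_teichmuller, lam_sum_teichmuller_eq_elemSymm]
  simp only [lam_sum_teichmuller_eq_elemSymm, teichmuller_prod, aeval_compPoly_elemSymm,
    elemPlethysm]

theorem IsPolynomialOperation.aeval
    {F : κ → ∀ (B : Type v) [CommRing B], (ι → LambdaSeries B) → LambdaSeries B}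
    (hF : ∀ k, IsPolynomialOperation (F k)) (p : MvPolynomial κ ℤ) :
    IsPolynomialOperation fun B _ f => MvPolynomial.aeval (fun k => F k B f) p := by
  induction p using MvPolynomial.induction_on with
  | C c =>
    convert map_intCast (ι := ι) (c : LambdaSeries ℤ) using 4 with B _ f
    rw [MvPolynomial.aeval_C, eq_intCast]
    exact (_root_.map_intCast (mapRingHom (Int.castRingHom B)) c).symm
  | add p q hp hq => simpa only [map_add] using hp.add hq
  | mul_X p k hp => simpa only [map_mul, MvPolynomial.aeval_X] using hp.mul (hF k)

open IsPolynomialOperation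

instance : LambdaRing (LambdaSeries A) where
  lam := lam
  lam_zero f := eq_of_forall_sum_teichmuller ((proj 0).lam 0) one
    (fun B _ N a => by rw [lam_sum_teichmuller_eq_elemSymm, elemSymm_zero]) ![f]
  lam_one f := eq_of_forall_sum_teichmuller ((proj 0).lam 1) (proj 0)
    (fun B _ N a => by rw [lam_sum_teichmuller_eq_elemSymm, elemSymm_one]) ![f]
  lam_add n f g := eq_of_forall_sum_teichmuller (((proj 0).add (proj 1)).lam n)
    (sum fun p : ℕ × ℕ => ((proj 0).lam p.1).mul ((proj 1).lam p.2))
    (fun B _ N a => by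
      simp only [sum_teichmuller_add_sum_teichmuller, lam_sum_teichmuller_eq_elemSymm,
        elemSymm_disjSum, Sum.elim_inl, Sum.elim_inr]) ![f, g]
  lam_of_one n hn := by
    simpa using! lam_sum_teichmuller_eq_zero (s := {()}) hn fun _ => (1 : A)
  lam_mul n f g := eq_of_forall_sum_teichmuller (((proj 0).mul (proj 1)).lam n)
    (.aeval (F := fun k _ _ h =>
        Sum.elim (fun i : Fin n => (h 0).lam (i + 1)) (fun j : Fin n => (h 1).lam (j + 1)) k)
      (Sum.rec (fun i => (proj 0).lam (i + 1)) fun j => (proj 1).lam (j + 1)) (mulPoly n))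
    (fun B _ N a => lam_sum_teichmuller_mul_sum_teichmuller n _ _ (a 0) (a 1)) ![f, g]
  lam_lam m n f := eq_of_forall_sum_teichmuller (((proj 0).lam n).lam m)
    (.aeval (fun i : Fin (m * n) => (proj 0).lam (i + 1)) (compPoly m n))
    (fun B _ N a => lam_lam_sum_teichmuller m n _ (a 0)) ![f]

end LambdaRing

section LambdaHom

variable {ι A : Type*} [CommRing A]

theorem isLineElement_teichmuller (a : A) : IsLineElement (teichmuller a) := fun n hn => by
  simpa using! lam_sum_teichmuller_eq_zero (s := {()}) hn fun _ => a

theorem isEvenElement_sum_teichmuller (s : Finset ι) (a : ι → A) :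
    IsEvenElement (∑ i ∈ s, teichmuller (a i)) :=
  ⟨s.card, fun _ hn => lam_sum_teichmuller_eq_zero hn a⟩

theorem coeff_teichmuller_eq_zero {n : ℕ} (hn : 1 < n) (a : A) : (teichmuller a).coeff n = 0 := by
  simpa [elemSymm_eq_zero_of_card_lt, hn] using coeff_sum_teichmuller {()} (fun _ => a) n

theorem coeff_add_teichmuller_succ (f : LambdaSeries A) (a : A) (n : ℕ) :
    (f + teichmuller a).coeff (n + 1) = f.coeff (n + 1) + a * f.coeff n := by
  change PowerSeries.coeff (n + 1) (f.toPowerSeries * (1 + PowerSeries.C a * PowerSeries.X)) = _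
  rw [mul_add, mul_one, mul_left_comm, map_add, PowerSeries.coeff_C_mul,
    PowerSeries.coeff_succ_mul_X]
  rfl

variable {R B : Type*} [LambdaRing R] [CommRing B]

/-- The power series `λ_t(x) = ∑ λⁿ(x) tⁿ`. -/
def lambdaT (x : R) : LambdaSeries R :=
  ofCoeff (fun n => LambdaRing.lam n x) (LambdaRing.lam_zero x)

@[simp]
theorem coeff_lambdaT (x : R) (n : ℕ) : (lambdaT x).coeff n = LambdaRing.lam n x :=
  coeff_ofCoeff _ _ n

theorem lambdaT_add (x y : R) : lambdaT (x + y) = lambdaT x + lambdaT y :=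
  ext_coeff fun n => by simp only [coeff_lambdaT, coeff_add, LambdaRing.lam_add]

theorem lambdaT_mul (x y : R) : lambdaT (x * y) = lambdaT x * lambdaT y :=
  ext_coeff fun n => by simp only [coeff_lambdaT, coeff_mul, LambdaRing.lam_mul]

theorem lambdaT_one : lambdaT (1 : R) = 1 := ext_coeff fun n => by
  have h_one : (1 : LambdaSeries R) = ∑ _i ∈ {()}, teichmuller 1 := (Finset.sum_singleton _ _).symm
  rw [h_one, coeff_lambdaT, coeff_sum_teichmuller]
  rcases n with _ | _ | n
  · rw [LambdaRing.lam_zero, elemSymm_zero]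
  · rw [LambdaRing.lam_one, elemSymm_one, Finset.sum_singleton]
  · rw [LambdaRing.lam_of_one _ (by lia), elemSymm_eq_zero_of_card_lt (by simp)]

theorem lambdaT_lam (n : ℕ) (x : R) : lambdaT (LambdaRing.lam n x) = lam n (lambdaT x) :=
  ext_coeff fun m => by simp only [coeff_lambdaT, coeff_lam, LambdaRing.lam_lam]

/-- The homomorphism of `λ`-rings `x ↦ λ_t(x)`, followed by a ring homomorphism on the
coefficients. -/
def mapLambdaT (φ : R →+* B) : LambdaRingHom R (LambdaSeries B) where
  toRingHom := (mapRingHom φ).comp (RingHom.mk' ⟨⟨lambdaT, lambdaT_one⟩, lambdaT_mul⟩ lambdaT_add)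
  map_lam n x := (congrArg (map φ) (lambdaT_lam n x)).trans (map_lam φ n _)

theorem mapLambdaT_apply (φ : R →+* B) (x : R) :
    (mapLambdaT φ).toRingHom x = map φ (lambdaT x) := rfl

theorem mapLambdaT_injective {φ : R →+* B} (hφ : Function.Injective φ) :
    Function.Injective (mapLambdaT φ).toRingHom := fun x y h => hφ <| by
  simpa [mapLambdaT_apply, LambdaRing.lam_one] using congrArg (coeff · 1) h

end LambdaHom

section Splitting

theorem exists_map_eq_sum_teichmuller {ι : Type*} [Finite ι] {A : Type v} [CommRing A] (N : ι → ℕ)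
    (f : ι → LambdaSeries A) (hf : ∀ i n, N i < n → (f i).coeff n = 0) :
    ∃ (B : Type v) (_ : CommRing B) (φ : A →+* B), Function.Injective φ ∧
      ∃ b : ∀ i, Fin (N i) → B, ∀ i, map φ (f i) = ∑ j, teichmuller (b i j) := by
  obtain ⟨B, _, φ, hφ, b, hb⟩ := exists_eqUpTo_sum_teichmuller N f
  refine ⟨B, inferInstance, φ, hφ, b, fun i => ext_coeff fun n => ?_⟩
  rcases le_or_gt n (N i) with hn | hn
  · exact hb i n hn
  · rw [coeff_map, hf i n hn, map_zero, coeff_sum_teichmuller,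
      elemSymm_eq_zero_of_card_lt (by simpa using hn)]

theorem exists_lambdaRingHom_eq_sum_sub_sum {R : Type v} [LambdaRing R] (x : R) {M N : ℕ}
    {p q : LambdaSeries R} (hp : ∀ n, M < n → p.coeff n = 0) (hq : ∀ n, N < n → q.coeff n = 0)
    (h : lambdaT x + q = p) :
    ∃ (R' : Type v) (_ : LambdaRing R') (f : LambdaRingHom R R'),
      Function.Injective f.toRingHom ∧
      (∃ (l : Fin M → R') (a : Fin N → R'), (∀ i, IsLineElement (l i)) ∧
        (∀ j, IsLineElement (a j)) ∧ f.toRingHom x = ∑ i, l i - ∑ j, a j) ∧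
      IsFiniteDimElement (f.toRingHom x) := by
  obtain ⟨B, _, φ, hφ, b, hb⟩ := exists_map_eq_sum_teichmuller ![M, N] ![p, q] <| by
    simpa [Fin.forall_fin_two] using ⟨hp, hq⟩
  have hx : (mapLambdaT φ).toRingHom x =
      ∑ i, teichmuller (b 0 i) - ∑ j, teichmuller (b 1 j) := by
    rw [← hb, ← hb, mapLambdaT_apply, eq_sub_iff_add_eq]
    exact (map_add (map φ) _ _).symm.trans (congrArg (map φ) h)
  exact ⟨LambdaSeries B, inferInstance, mapLambdaT φ, mapLambdaT_injective hφ,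
    ⟨fun i => teichmuller (b 0 i), fun j => teichmuller (b 1 j),
      fun _ => isLineElement_teichmuller _, fun _ => isLineElement_teichmuller _, hx⟩,
    _, _, isEvenElement_sum_teichmuller _ _, isEvenElement_sum_teichmuller _ _, hx⟩

end Splitting

end

end LambdaSeries

section TwoColumnHook

/-- The partition `(2, 1, …, 1)` with `n` parts equal to `1`. -/
def twoColumnHook (n : ℕ) : YoungDiagram :=
  YoungDiagram.ofRowLens (2 :: List.replicate n 1) <| by
    simp [List.sortedGE_iff_pairwise, List.pairwise_replicate]

theorem mem_twoColumnHook {n i j : ℕ} :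
    (i, j) ∈ twoColumnHook n ↔ i < n + 1 ∧ j = 0 ∨ i = 0 ∧ j = 1 := by
  rw [twoColumnHook, YoungDiagram.mem_ofRowLens]
  rcases i with _ | i
  · simp
    lia
  · simp

theorem twoColumnHook_mono : Monotone twoColumnHook := by
  rintro m n hmn ⟨i, j⟩ h
  rw [mem_twoColumnHook] at h ⊢
  lia

theorem rowLen_zero_twoColumnHook (n : ℕ) : (twoColumnHook n).rowLen 0 = 2 :=
  eq_of_forall_lt_iff fun j => by
    rw [← YoungDiagram.mem_iff_lt_rowLen, mem_twoColumnHook]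
    lia

theorem colLen_zero_twoColumnHook (n : ℕ) : (twoColumnHook n).colLen 0 = n + 1 :=
  eq_of_forall_lt_iff fun i => by
    rw [← YoungDiagram.mem_iff_lt_colLen, mem_twoColumnHook]
    lia

theorem colLen_one_twoColumnHook (n : ℕ) : (twoColumnHook n).colLen 1 = 1 :=
  eq_of_forall_lt_iff fun i => by
    rw [← YoungDiagram.mem_iff_lt_colLen, mem_twoColumnHook]
    lia

theorem schurFn_eq_of_rowLen_eq_two {μ : YoungDiagram} (h : μ.rowLen 0 = 2) :
    schurFn μ = elemFn (μ.colLen 0) * elemFn (μ.colLen 1) -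
      elemFn (μ.colLen 0 + 1) * elemFn (μ.colLen 1 - 1) := by
  rw [schurFn, h, Matrix.det_fin_two]
  simp

theorem evalSymm_elemFn {R : Type*} [LambdaRing R] (x : R) (k : ℕ) :
    evalSymm x (elemFn k) = LambdaRing.lam k x := by
  rcases k with _ | k
  · simp [elemFn, LambdaRing.lam_zero]
  · rw [elemFn, if_neg (by lia), if_neg (by lia), evalSymm]
    simp

theorem evalSymm_schurFn_twoColumnHook {R : Type*} [LambdaRing R] (x : R) (n : ℕ) :
    evalSymm x (schurFn (twoColumnHook n)) =
      LambdaRing.lam (n + 1) x * x - LambdaRing.lam (n + 2) x := by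
  have h_zero : ((1 : ℕ) : ℤ) - 1 = (0 : ℕ) := rfl
  rw [schurFn_eq_of_rowLen_eq_two (rowLen_zero_twoColumnHook n), colLen_zero_twoColumnHook,
    colLen_one_twoColumnHook, h_zero, ← Nat.cast_succ]
  simp only [map_sub, map_mul, evalSymm_elemFn, LambdaRing.lam_zero, LambdaRing.lam_one, mul_one]

end TwoColumnHook

open LambdaSeries in
theorem coeff_lambdaT_add_teichmuller_neg_eq_zero {R : Type*} [LambdaRing R] {n : ℕ} {x : R}
    (hx : HasBound x (twoColumnHook n)) {k : ℕ} (hk : n + 1 < k) :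
    (lambdaT x + teichmuller (-x)).coeff k = 0 := by
  obtain ⟨k, rfl⟩ := Nat.exists_eq_add_of_lt hk
  have h_schur := hx _ (twoColumnHook_mono (Nat.le_add_right n k))
  rw [evalSymm_schurFn_twoColumnHook] at h_schur
  rw [Nat.add_right_comm n 1 k, coeff_add_teichmuller_succ, coeff_lambdaT, coeff_lambdaT]
  linear_combination -h_schur

open LambdaSeries in
theorem mainTheorem4_general {R : Type u} [LambdaRing R] (n : ℕ) (x : R)
    (hx : HasBound x (twoColumnHook n)) :
    ∃ (R' : Type u) (_ : LambdaRing R') (f : LambdaRingHom R R'),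
      Function.Injective f.toRingHom ∧
      (∃ (l : Fin (n + 1) → R') (a : R'), (∀ i, IsLineElement (l i)) ∧ IsLineElement a ∧
        f.toRingHom x = ∑ i, l i - a) ∧
      IsFiniteDimElement (f.toRingHom x) := by
  obtain ⟨R', _, f, hf, ⟨l, a, hl, ha, hx_eq⟩, hfin⟩ :=
    exists_lambdaRingHom_eq_sum_sub_sum (N := 1) x (q := teichmuller (-x))
      (fun _ => coeff_lambdaT_add_teichmuller_neg_eq_zero hx)
      (fun _ hk => coeff_teichmuller_eq_zero hk _) rfl
  exact ⟨R', _, f, hf, ⟨l, a 0, hl, ha 0, by rwa [Fin.sum_univ_one] at hx_eq⟩, hfin⟩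

theorem mainTheorem4 {R : Type u} [LambdaRing R] (x : R) (hx : HasBound x hookTwoOne) :
    ∃ (R' : Type u) (_ : LambdaRing R') (f : LambdaRingHom R R'),
      Function.Injective f.toRingHom ∧
      (∃ l₁ l₂ a : R', IsLineElement l₁ ∧ IsLineElement l₂ ∧ IsLineElement a ∧
        f.toRingHom x = l₁ + l₂ - a) ∧
      IsFiniteDimElement (f.toRingHom x) := by
  obtain ⟨R', _, f, hf, ⟨l, a, hl, ha, hx_eq⟩, hfin⟩ := mainTheorem4_general 1 x hx
  exact ⟨R', _, f, hf, ⟨l 0, l 1, a, hl 0, hl 1, ha, by rwa [Fin.sum_univ_two] at hx_eq⟩, hfin⟩
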